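/- **Setting.** Fix a relational signature $\Sigma$ (a set of relation symbols, each of some finite arity) and a class $\mathcal C$ of $\Sigma$-structures, finite or infinite, with non-empty universes. A monadic extension $\Sigma^+$ of $\Sigma$ adds unary predicates to $\Sigma$, and $\mathcal C[\Sigma^+]$ is the class of all $\Sigma^+$-structures whose $\Sigma$-reduct is in $\mathcal C$. Formulas are first-order and without parameters. For a class $\mathcal D$ of structures, a formula $\varphi(\bar x,\bar y)$ has the *order property* on $\mathcal D$ if for every $k\in\mathbb N$ there are $A\in\mathcal D$ and tuples $\bar a_1,\dots,\bar a_k,\bar b_1,\dots,\bar b_k$ in $A$ such that $A\models\varphi(\bar a_i,\bar b_j)\iff i\le j$ for all $i,j$. It has the *independence property* on $\mathcal D$ if for every $n$ there are $A\in\mathcal D$ and a set $X\subseteq A^{|\bar x|}$ with at least $n$ elements such that for every $Y\subseteq X$ there is a tuple $\bar b_Y$ in $A$ with $A\models\varphi(\bar a,\bar b_Y)\iff \bar a\in Y$ for all $\bar a\in X$. The class $\mathcal D$ is *stable* (*NIP*) if no formula has the order property (the independence property) on $\mathcal D$; and $\mathcal C$ is *monadically stable* (*monadically NIP*) if $\mathcal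 C[\Sigma^+]$ is stable (NIP) for every monadic extension $\Sigma^+$ of $\Sigma$. For a formula $\varphi(\bar x,y)$ with a single variable $y$ and a tuple $\bar a$ in $A$ put $N_\varphi(\bar a)=\{b\in A : A\models\varphi(\bar a,b)\}$. **Theorem.** Let $\mathcal C$ be a monadically NIP class of $\Sigma$-structures, and let $\varphi(x,y)$ and $\alpha(\bar x,y)$ be $\Sigma$-formulas, where $x,y$ are single variables and $\bar x$ is a finite tuple of variables. Then there are a function $N:\mathbb N\to\mathbb N$ and an integer $k$ such that the following holds for every $m\ge 1$, every $A\in\mathcal C$, and every sequence $J=(\bar c_1,\dots,\bar c_{N(m)})$ of $|\bar x|$-tuples of elements of $A$ with $N_\alpha(\bar c_i)\cap N_\alpha(\bar c_j)=\varnothing$ for all $i\ne j$. There are a subsequence $I=(\bar a_1,\dots,\bar a_m)$ of $J$ of length $m$ and a set $S\subseteq A$ with $|S|\le k$ such that for every element $a\in A$ there are an index $\mathrm{ex}(a)\in\{1,\dots,m\}$ and elements $s_<(a),s_>(a)\in S$ with $$N_\alpha(\bar a_i)\cap N_\varphi(a)=N_\alpha(\bar a_i)\cap N_\varphi(s_<(a))\quad\text{for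 all } 1\le i<\mathrm{ex}(a),$$ $$N_\alpha(\bar a_i)\cap N_\varphi(a)=N_\alpha(\bar a_i)\cap N_\varphi(s_>(a))\quad\text{for all } \mathrm{ex}(a)<i\le m,$$ and such that $a\in N_\alpha(\bar a_i)$ implies $i=\mathrm{ex}(a)$. If moreover $\mathcal C$ is monadically stable, then these can be chosen with $s_<(a)=s_>(a)$ for every $a\in A$. -/

import Mathlib

open FirstOrder CategoryTheory

universe u v w

namespace MonadicNIP

/-- The relation symbols that name a family `κ` of colors: one unary symbol for each color. -/
inductive ColorRel (κ : Type) : ℕ → Type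
  | color (c : κ) : ColorRel κ 1

/-- The signature consisting of the unary predicates (colors) indexed by `κ`. -/
def colorLang (κ : Type) : FirstOrder.Language.{0, 0} := ⟨fun _ => Empty, ColorRel κ⟩

/-- The monadic extension of the signature `L` by unary predicates indexed by `κ`. -/
abbrev monadicExt (L : FirstOrder.Language.{u, v}) (κ : Type) : FirstOrder.Language.{u, v} :=
  L.sum (colorLang κ)

variable {L : FirstOrder.Language.{u, v}}

/-- The class of all monadic expansions (colorings with colors `κ`) of structures of the class `C`:
the structures over the extended signature whose `L`-reduct belongs to `C`. -/
def monadicExpansions (C : Set (Bundled.{w} L.Structure)) (κ : Type) :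
    Set (Bundled.{w} (monadicExt L κ).Structure) :=
  {A | (⟨A, (FirstOrder.Language.LHom.sumInl : L →ᴸ monadicExt L κ).reduct A⟩ :
    Bundled.{w} L.Structure) ∈ C}

/-- The `φ`-neighborhood of the tuple `a`: all tuples `b` such that `φ(a, b)` holds. -/
def tupleNbhd {M : Type w} [L.Structure M] {p q : ℕ} (φ : L.Formula (Fin p ⊕ Fin q))
    (a : Fin p → M) : Set (Fin q → M) :=
  {b | φ.Realize (Sum.elim a b)}

/-- The neighborhood of a tuple for a formula whose second argument is a single variable, as a set
of elements of the structure. -/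
def nbhd {M : Type w} [L.Structure M] {p : ℕ} (φ : L.Formula (Fin p ⊕ Fin 1))
    (a : Fin p → M) : Set M :=
  {b | (fun _ => b) ∈ tupleNbhd φ a}

/-- The `k`-order property of a partitioned formula on a class of structures. -/
def HasOrderPropertyOfLength (C : Set (Bundled.{w} L.Structure)) {p q : ℕ}
    (φ : L.Formula (Fin p ⊕ Fin q)) (k : ℕ) : Prop :=
  ∃ A ∈ C, ∃ (a : Fin k → Fin p → A) (b : Fin k → Fin q → A),
    ∀ i j, b j ∈ tupleNbhd φ (a i) ↔ i ≤ j

/-- A class is stable if no formula has the order property (the `k`-order property for all `k`). -/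
def IsStable (C : Set (Bundled.{w} L.Structure)) : Prop :=
  ∀ (p q : ℕ) (φ : L.Formula (Fin p ⊕ Fin q)), ¬ ∀ k, HasOrderPropertyOfLength C φ k

/-- A set `X` of tuples is shattered by `φ(x, y)`. -/
def Shatters {M : Type w} [L.Structure M] {p q : ℕ} (φ : L.Formula (Fin p ⊕ Fin q))
    (X : Set (Fin p → M)) : Prop :=
  ∃ b : Set (Fin p → M) → (Fin q → M), ∀ J ⊆ X, ∀ a ∈ X, b J ∈ tupleNbhd φ a ↔ a ∈ J

/-- The independence property: `φ` shatters arbitrarily large sets in structures from `C`. -/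
def HasIP (C : Set (Bundled.{w} L.Structure)) {p q : ℕ} (φ : L.Formula (Fin p ⊕ Fin q)) : Prop :=
  ∀ n : ℕ, ∃ A ∈ C, ∃ X : Set (Fin p → A), (n : ℕ∞) ≤ X.encard ∧ Shatters φ X

/-- A class is NIP if no formula has the independence property over it. -/
def IsNIP (C : Set (Bundled.{w} L.Structure)) : Prop :=
  ∀ (p q : ℕ) (φ : L.Formula (Fin p ⊕ Fin q)), ¬ HasIP C φ

/-- A class is monadically stable if its class of colorings is stable, for every set of colors.
(A formula mentions finitely many colors, so color sets in `Type` give all monadic extensions.) -/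
def IsMonadicallyStable (C : Set (Bundled.{w} L.Structure)) : Prop :=
  ∀ κ : Type, IsStable (monadicExpansions C κ)

/-- A class is monadically NIP if its class of colorings is NIP, for every set of colors. -/
def IsMonadicallyNIP (C : Set (Bundled.{w} L.Structure)) : Prop :=
  ∀ κ : Type, IsNIP (monadicExpansions C κ)

end MonadicNIP

/-! Monadic NIP is used only through grids. Suppose elements `e k l` are such that one formula
recovers `k` and another recovers `l`. Marking an arbitrary set of them by a unary predicate then
turns the pair of formulas into an arbitrary bipartite graph, which yields the independence
property. So coded grids have bounded size (`IsMonadicallyNIP.exists_not_gridCoded`), and Ramsey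
arguments turn this bound into structure.

First consequence: reading the finite type of `z` over each member of a sequence gives a word. If
words with two separate changes persisted on all subsequences, two of their special positions could
be moved independently, coding a grid. Hence on a subsequence each word is constant on either side
of one exceptional position (`IsMonadicallyNIP.exists_exceptional_subsequence`). In the stable case,
long constant blocks with different letters would define half-graphs, so the two constants agree.

Second consequence: only boundedly many elements can have pairwise distinct traces on each of many
disjoint neighborhoods (`IsMonadicallyNIP.exists_bound_distinct_traces`).

For the theorem, collect greedily samples whose traces differ along many indices. At most a bounded
number occur, and once the family is maximal every `a` shares its trace with some sample at all but
few indices. Apply the first consequence to the letters recording which samples agree with `a` at an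
index, and whether `a` lies in that neighborhood. A long constant block must name a sample, which
serves for the whole block; by disjointness no repeated letter can record membership. -/

/-! ### Finite Ramsey theorems -/

/-- Finite Ramsey theorem for `r`-element subsets of a linearly ordered set. -/
theorem ramsey_finset (κ : Type*) [Finite κ] (r m : ℕ) : ∃ N, ∀ {ι : Type} [LinearOrder ι]
    (c : Finset ι → κ) (H : Finset ι), N ≤ H.card →
      ∃ T ⊆ H, T.card = m ∧ ∃ k, ∀ s ⊆ T, s.card = r → c s = k := by
  classical
  induction r generalizing m with
  | zero =>
    refine ⟨m, fun c H hH => ?_⟩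
    obtain ⟨T, hT, hc⟩ := Finset.exists_subset_card_eq hH
    exact ⟨T, hT, hc, c ∅, fun s _ h => by rw [Finset.card_eq_zero.1 h]⟩
  | succ r ih =>
    -- End-homogeneous sets: the color of an `(r+1)`-set depends only on its least element.
    -- Pigeonhole on `d` then gives a homogeneous set.
    have step : ∀ n, ∃ N, ∀ {ι : Type} [LinearOrder ι] (c : Finset ι → κ) (H : Finset ι),
        N ≤ H.card → ∃ T ⊆ H, T.card = n ∧ ∃ d : ι → κ, ∀ x ∈ T, ∀ s ⊆ T,
          (∀ y ∈ s, x < y) → s.card = r → c (insert x s) = d x := by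
      intro n
      induction n with
      | zero => 
        refine ⟨1, fun c H hH => ⟨∅, by simp, rfl, fun _ => c ∅, by simp⟩⟩
      | succ n ihn =>
        obtain ⟨N₁, h₁⟩ := ihn
        obtain ⟨N₂, h₂⟩ := ih N₁
        refine ⟨N₂ + 1, fun {ι} _ c H hH => ?_⟩
        have hne : H.Nonempty := Finset.card_pos.1 (by omega)
        set x₀ := H.min' hne with hx₀
        have hx₀H : x₀ ∈ H := H.min'_mem hne
        obtain ⟨T₂, hT₂, hc₂, k, hk⟩ := h₂ (fun s => c (insert x₀ s)) (H.erase x₀)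
          (by rw [Finset.card_erase_of_mem hx₀H]; omega)
        obtain ⟨T₁, hT₁, hc₁, d, hd⟩ := h₁ c T₂ hc₂.ge
        have hlt : ∀ y ∈ T₁, x₀ < y := fun y hy =>
          H.min'_lt_of_mem_erase_min' hne (hT₂ (hT₁ hy))
        have hx₀T : x₀ ∉ T₁ := fun h => lt_irrefl _ (hlt _ h)
        refine ⟨insert x₀ T₁, ?_, by rw [Finset.card_insert_of_notMem hx₀T, hc₁],
          fun x => if x = x₀ then k else d x, ?_⟩
        · refine Finset.insert_subset hx₀H fun y hy => ?_
          exact Finset.mem_of_mem_erase (hT₂ (hT₁ hy))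
        · intro x hx s hs hxs hcs
          have hsT : s ⊆ T₁ := by
            intro y hy
            rcases Finset.mem_insert.1 (hs hy) with h | h
            · subst h
              rcases Finset.mem_insert.1 hx with h | h
              · exact absurd (hxs _ hy) (by rw [h]; exact lt_irrefl _)
              · exact absurd (hxs _ hy) (hlt _ h).not_gt
            · exact h
          rcases Finset.mem_insert.1 hx with h | h
          · simp only [h, if_true]
            exact hk s (hsT.trans hT₁) hcs
          · have : x ≠ x₀ := fun e => hx₀T (e ▸ h)
            simp only [this, if_false]
            exact hd x h s hsT hxs hcs
    have := Fintype.ofFinite κ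
    obtain ⟨N, hN⟩ := step (Fintype.card κ * m + 1)
    refine ⟨N, fun {ι} _ c H hH => ?_⟩
    obtain ⟨T, hT, hc, d, hd⟩ := hN c H hH
    obtain ⟨k, -, hk⟩ := Finset.exists_lt_card_fiber_of_mul_lt_card_of_maps_to
      (s := T) (t := Finset.univ) (f := d) (n := m) (fun _ _ => Finset.mem_univ _)
      (by rw [hc, Finset.card_univ]; omega)
    obtain ⟨T', hT', hc'⟩ := Finset.exists_subset_card_eq hk.le
    refine ⟨T', hT'.trans ((Finset.filter_subset _ _).trans hT), hc', k, fun s hs hcs => ?_⟩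
    have hne : s.Nonempty := Finset.card_pos.1 (by omega)
    have hmem := hT' (hs (s.min'_mem hne))
    rw [Finset.mem_filter] at hmem
    rw [← hmem.2, ← hd _ hmem.1 (s.erase (s.min' hne)), Finset.insert_erase (s.min'_mem hne)]
    · exact (Finset.erase_subset _ _).trans (hs.trans (hT'.trans (Finset.filter_subset _ _)))
    · exact fun y hy => s.min'_lt_of_mem_erase_min' hne hy
    · rw [Finset.card_erase_of_mem (s.min'_mem hne)]; omega

/-- Finite Ramsey theorem for increasing `r`-tuples. -/
theorem ramsey (κ : Type*) [Finite κ] (r m : ℕ) : ∃ N, ∀ c : (Fin r → Fin N) → κ,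
    ∃ g : Fin m → Fin N, StrictMono g ∧ ∃ k, ∀ e : Fin r → Fin m, StrictMono e →
      c (fun t => g (e t)) = k := by
  classical
  rcases isEmpty_or_nonempty κ with hκ | ⟨⟨k₀⟩⟩
  -- With no colors, length `r` guarantees that a tuple to color exists, which is absurd.
  · refine ⟨r, fun c => (hκ.false (c id)).elim⟩
  obtain ⟨N, hN⟩ := ramsey_finset κ r m
  refine ⟨N, fun c => ?_⟩
  obtain ⟨T, -, hc, k, hk⟩ := hN
    (fun s : Finset (Fin N) => if h : s.card = r then c (s.orderEmbOfFin h) else k₀)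
    Finset.univ (by simp)
  refine ⟨T.orderEmbOfFin hc, (T.orderEmbOfFin hc).strictMono, k, fun e he => ?_⟩
  have hmono : StrictMono fun t => T.orderEmbOfFin hc (e t) :=
    (T.orderEmbOfFin hc).strictMono.comp he
  have hcard : (Finset.univ.image fun t => T.orderEmbOfFin hc (e t)).card = r := by
    rw [Finset.card_image_of_injective _ hmono.injective, Finset.card_fin]
  have := hk (Finset.univ.image fun t => T.orderEmbOfFin hc (e t)) (by
    intro y hy
    obtain ⟨t, -, rfl⟩ := Finset.mem_image.1 hy
    exact Finset.orderEmbOfFin_mem _ _ _) hcard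
  rw [dif_pos hcard] at this
  rw [← this]
  congr 1
  exact Finset.orderEmbOfFin_unique hcard
    (fun t => Finset.mem_image_of_mem _ (Finset.mem_univ _)) hmono

/-! ### Words with an exceptional position, and grids coded by words -/

/-- A word without a subword `u x y v` with `u ≠ x` and `y ≠ v` is constant before and after some
exceptional position. -/
theorem exists_exceptional_position {Γ : Type*} {m : ℕ} (hm : 1 ≤ m) (s : Fin m → Γ)
    (h : ∀ f : Fin 4 → Fin m, StrictMono f → s (f 0) ≠ s (f 1) → s (f 2) = s (f 3)) :
    ∃ (ex : Fin m) (u v : Γ), (∀ i < ex, s i = u) ∧ ∀ i, ex < i → s i = v := by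
  by_cases hc : ∃ i : Fin m, ∃ j < i, s j ≠ s i
  -- `ex` is the first index whose letter differs from an earlier one. A later letter that differs
  -- from the last letter would complete the forbidden pattern.
  · obtain ⟨ex, ⟨j, hj, hne⟩, hmin⟩ :=
      WellFounded.has_min (wellFounded_lt (α := Fin m)) {i | ∃ j < i, s j ≠ s i} hc
    refine ⟨ex, s j, s ⟨m - 1, by omega⟩, fun i hi => ?_, fun i hi => ?_⟩
    · by_contra hij
      rcases lt_trichotomy i j with h1 | h1 | h1
      · exact hmin j ⟨i, h1, hij⟩ hj
      · exact hij (h1 ▸ rfl)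
      · exact hmin i ⟨j, h1, Ne.symm hij⟩ hi
    · rcases (show i ≤ ⟨m - 1, by omega⟩ by
        rw [Fin.le_def]; exact Nat.le_sub_one_of_lt i.2).eq_or_lt with h1 | h1
      · rw [← h1]
      · refine h ![j, ex, i, ⟨m - 1, by omega⟩] ?_ hne
        rw [Fin.strictMono_iff_lt_succ]
        intro t
        fin_cases t
        exacts [hj, hi, h1]
  · push Not at hc
    have key : ∀ i j, s i = s j := fun i j => by
      rcases lt_trichotomy i j with h1 | h1 | h1
      exacts [hc _ _ h1, h1 ▸ rfl, (hc _ _ h1).symm]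
    exact ⟨⟨0, hm⟩, s ⟨0, hm⟩, s ⟨0, hm⟩, fun i _ => key _ _, fun i _ => key _ _⟩

/-- The position with offset `t` in the `k`-th of `n` consecutive triples starting at `lo`. -/
def triplePos {M : ℕ} (lo n : ℕ) (h : lo + 3 * n ≤ M) (k : ℕ) (hk : k < n) (t : Fin 3) : Fin M :=
  ⟨lo + 3 * k + t, by omega⟩

/-- A word of the form `P…P u Q…Q`, not constant, is read off correctly by the triple around its
exceptional position, and only by this triple. -/
theorem triple_eq_iff {Γ : Type*} {M : ℕ} (s : Fin M → Γ) {lo n : ℕ} (h : lo + 3 * n ≤ M)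
    {k k' : ℕ} (hk : k < n) (hk' : k' < n) {P u Q : Γ} (hne : ¬ (P = u ∧ u = Q))
    (hP : ∀ i : Fin M, lo ≤ i → (i : ℕ) < lo + 3 * k + 1 → s i = P)
    (hu : s (triplePos lo n h k hk 1) = u)
    (hQ : ∀ i : Fin M, lo + 3 * k + 1 < i → (i : ℕ) < lo + 3 * n → s i = Q) :
    (∀ t, s (triplePos lo n h k' hk' t) = ![P, u, Q] t) ↔ k' = k := by
  constructor
  · intro H
    by_contra hkk
    -- A triple to the left reads `PPP` and one to the right `QQQ`; neither can equal `PuQ`.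
    rcases Nat.lt_or_gt_of_ne hkk with hlt | hlt
    · have key : ∀ t, P = ![P, u, Q] t := fun t => by
        rw [← H t]; exact (hP _ (by simp [triplePos]; omega) (by simp [triplePos]; omega)).symm
      exact hne ⟨key 1, (key 1).symm.trans (key 2)⟩
    · have key : ∀ t, Q = ![P, u, Q] t := fun t => by
        rw [← H t]; exact (hQ _ (by simp [triplePos]; omega) (by simp [triplePos]; omega)).symm
      exact hne ⟨(key 0).symm.trans (key 1), (key 1).symm⟩
  · rintro rfl t
    fin_cases t
    · exact hP _ (by simp [triplePos]) (by simp [triplePos])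
    · exact hu
    · exact hQ _ (by simp [triplePos]) (by simp [triplePos]; omega)

/-- Elements `e k l` for which `P k' ∧ Q l'` singles out the pair `(k, l)`. -/
def GridCoded {Z : Type*} {n : ℕ} (P Q : Fin n → Z → Prop) : Prop :=
  ∃ e : Fin n → Fin n → Z, ∀ k l k' l', P k' (e k l) ∧ Q l' (e k l) ↔ k' = k ∧ l' = l

/-- Among words `A…A a B…B b C…C c D…D d E…E` with `a ≠ b` and `c ≠ d`, two of the four special
positions can be varied independently and recovered from triples. -/
theorem gridCoded_of_words {Γ Z : Type*} {n M : ℕ} (hM : M = 6 * n + 4) (w : Fin M → Z → Γ)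
    (e : (Fin 4 → Fin M) → Z) {A B C D E a b c d : Γ} (hab : a ≠ b) (hcd : c ≠ d)
    (hw : ∀ i₁ i₂ i₃ i₄ : Fin M, i₁ < i₂ → i₂ < i₃ → i₃ < i₄ →
      (∀ i < i₁, w i (e ![i₁, i₂, i₃, i₄]) = A) ∧ w i₁ (e ![i₁, i₂, i₃, i₄]) = a ∧
      (∀ i, i₁ < i → i < i₂ → w i (e ![i₁, i₂, i₃, i₄]) = B) ∧ w i₂ (e ![i₁, i₂, i₃, i₄]) = b ∧
      (∀ i, i₂ < i → i < i₃ → w i (e ![i₁, i₂, i₃, i₄]) = C) ∧ w i₃ (e ![i₁, i₂, i₃, i₄]) = c ∧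
      (∀ i, i₃ < i → i < i₄ → w i (e ![i₁, i₂, i₃, i₄]) = D) ∧ w i₄ (e ![i₁, i₂, i₃, i₄]) = d ∧
      (∀ i, i₄ < i → w i (e ![i₁, i₂, i₃, i₄]) = E)) :
    ∃ (p q : Fin 3 → Γ) (x y : Fin n → Fin 3 → Fin M),
      GridCoded (fun k z => ∀ t, w (x k t) z = p t) (fun l z => ∀ t, w (y l t) z = q t) := by
  -- Layout: triples occupy `1..3n` and `3n+3..6n+2`; the positions `0`, `3n+1`, `3n+2`, `6n+3` are
  -- parking places. In each half one special position sits at the center of a triple and the other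
  -- is parked. The first moves if it is visible; if it is hidden by `A = a = B` (resp. `C = c =
  -- D`), the second is visible because `a ≠ b` (resp. `c ≠ d`).
  have h₁ : 1 + 3 * n ≤ M := by omega
  have h₂ : 3 * n + 3 + 3 * n ≤ M := by omega
  have low : ∃ (p : Fin 3 → Γ) (I : Fin n → Fin M × Fin M), ∀ k, (I k).1 < (I k).2 ∧
      ((I k).2 : ℕ) ≤ 3 * n + 1 ∧ ∀ s : Fin M → Γ, (∀ i < (I k).1, s i = A) → s (I k).1 = a →
        (∀ i, (I k).1 < i → i < (I k).2 → s i = B) → s (I k).2 = b →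
        (∀ i : Fin M, (I k).2 < i → (i : ℕ) ≤ 3 * n + 1 → s i = C) →
        ∀ k' : Fin n, (∀ t, s (triplePos 1 n h₁ k' k'.2 t) = p t) ↔ k' = k := by
    by_cases hev : A = a ∧ a = B
    · refine ⟨![B, b, C], fun k => (⟨0, by omega⟩, triplePos 1 n h₁ k k.2 1), fun k => ⟨?_, ?_, ?_⟩⟩
      · simp [Fin.lt_def, triplePos]
      · simp [triplePos]; omega
      · intro s _ _ hB hb hC k'
        rw [Fin.ext_iff]
        refine triple_eq_iff s h₁ k.2 k'.2 (fun h => hab (hev.2.trans h.1)) ?_ hb ?_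
        · intro i hi hi'
          exact hB i (by rw [Fin.lt_def]; exact hi) (by rw [Fin.lt_def]; exact hi')
        · intro i hi hi'
          exact hC i (by rw [Fin.lt_def]; exact hi) (by omega)
    · refine ⟨![A, a, B], fun k => (triplePos 1 n h₁ k k.2 1, ⟨3 * n + 1, by omega⟩),
        fun k => ⟨?_, ?_, ?_⟩⟩
      · simp [Fin.lt_def, triplePos]; omega
      · simp
      · intro s hA ha hB _ _ k'
        rw [Fin.ext_iff]
        refine triple_eq_iff s h₁ k.2 k'.2 hev ?_ ha ?_
        · intro i hi hi'
          exact hA i (by rw [Fin.lt_def]; exact hi')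
        · intro i hi hi'
          exact hB i (by rw [Fin.lt_def]; exact hi) (by rw [Fin.lt_def]; simp; omega)
  have up : ∃ (q : Fin 3 → Γ) (I : Fin n → Fin M × Fin M), ∀ l, (I l).1 < (I l).2 ∧
      3 * n + 2 ≤ ((I l).1 : ℕ) ∧ ∀ s : Fin M → Γ,
        (∀ i : Fin M, 3 * n + 2 ≤ (i : ℕ) → i < (I l).1 → s i = C) → s (I l).1 = c →
        (∀ i, (I l).1 < i → i < (I l).2 → s i = D) → s (I l).2 = d →
        (∀ i, (I l).2 < i → s i = E) →
        ∀ l' : Fin n, (∀ t, s (triplePos (3 * n + 3) n h₂ l' l'.2 t) = q t) ↔ l' = l := by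
    by_cases hev : C = c ∧ c = D
    · refine ⟨![D, d, E], fun k => (⟨3 * n + 2, by omega⟩, triplePos (3 * n + 3) n h₂ k k.2 1),
        fun k => ⟨?_, ?_, ?_⟩⟩
      · simp [Fin.lt_def, triplePos]; omega
      · simp
      · intro s _ _ hB hb hC k'
        rw [Fin.ext_iff]
        refine triple_eq_iff s h₂ k.2 k'.2 (fun h => hcd (hev.2.trans h.1)) ?_ hb ?_
        · intro i hi hi'
          exact hB i (by rw [Fin.lt_def]; simp; omega) (by rw [Fin.lt_def]; exact hi')
        · intro i hi hi'
          exact hC i (by rw [Fin.lt_def]; exact hi)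
    · refine ⟨![C, c, D], fun k => (triplePos (3 * n + 3) n h₂ k k.2 1, ⟨6 * n + 3, by omega⟩),
        fun k => ⟨?_, ?_, ?_⟩⟩
      · simp [Fin.lt_def, triplePos]; omega
      · simp [triplePos]; omega
      · intro s hA ha hB _ _ k'
        rw [Fin.ext_iff]
        refine triple_eq_iff s h₂ k.2 k'.2 hev ?_ ha ?_
        · intro i hi hi'
          exact hA i (by omega) (by rw [Fin.lt_def]; exact hi')
        · intro i hi hi'
          exact hB i (by rw [Fin.lt_def]; exact hi) (by rw [Fin.lt_def]; simp; omega)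
  obtain ⟨p, I, hI⟩ := low
  obtain ⟨q, I', hI'⟩ := up
  refine ⟨p, q, fun k t => triplePos 1 n h₁ k k.2 t,
    fun k t => triplePos (3 * n + 3) n h₂ k k.2 t,
    fun k l => e ![(I k).1, (I k).2, (I' l).1, (I' l).2], fun k l k' l' => ?_⟩
  obtain ⟨h12, h2, hs⟩ := hI k
  obtain ⟨h34, h3, hs'⟩ := hI' l
  obtain ⟨hA, ha, hB, hb, hC, hc, hD, hd, hE⟩ := hw _ _ _ _ h12
    (show (I k).2 < (I' l).1 by rw [Fin.lt_def]; omega) h34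
  refine and_congr (hs _ hA ha hB hb (fun i h h' => hC i h ?_) k')
    (hs' _ (fun i h h' => hC i ?_ h') hc hD hd hE l')
  · rw [Fin.lt_def]; omega
  · rw [Fin.lt_def]; omega

theorem strictMono_vec4 {m : ℕ} {a b c d : Fin m} (h₁ : a < b) (h₂ : b < c) (h₃ : c < d) :
    StrictMono ![a, b, c, d] := by
  rw [Fin.strictMono_iff_lt_succ]
  intro t
  fin_cases t
  exacts [h₁, h₂, h₃]

theorem strictMono_vec5 {m : ℕ} {a b c d e : Fin m} (h₁ : a < b) (h₂ : b < c) (h₃ : c < d)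
    (h₄ : d < e) : StrictMono ![a, b, c, d, e] := by
  rw [Fin.strictMono_iff_lt_succ]
  intro t
  fin_cases t
  exacts [h₁, h₂, h₃, h₄]

/-- If no grid is coded by the letters of words indexed by a long sequence, then on a subsequence
every word is constant before and after an exceptional position. -/
theorem exists_exceptional_subsequence (Γ : Type*) [Finite Γ]
    (n : (Fin 3 → Γ) → (Fin 3 → Γ) → ℕ) {m : ℕ} (hm : 1 ≤ m) :
    ∃ N, ∀ {Z : Type w} (W : Fin N → Z → Γ),
      (∀ p q (x y : Fin (n p q) → Fin 3 → Fin N),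
        ¬ GridCoded (fun k z => ∀ t, W (x k t) z = p t) (fun l z => ∀ t, W (y l t) z = q t)) →
      ∃ g : Fin m → Fin N, StrictMono g ∧ ∀ z, ∃ (ex : Fin m) (u v : Γ),
        (∀ i < ex, W (g i) z = u) ∧ ∀ i, ex < i → W (g i) z = v := by
  classical
  have := Fintype.ofFinite Γ
  set n₀ := ∑ p, ∑ q, n p q with hn₀
  have hle : ∀ p q, n p q ≤ n₀ := fun p q =>
    (Finset.single_le_sum (f := fun q => n p q) (fun _ _ => Nat.zero_le _)
      (Finset.mem_univ q)).trans
    (Finset.single_le_sum (f := fun p => ∑ q, n p q) (fun _ _ => Nat.zero_le _)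
      (Finset.mem_univ p))
  -- The outer application, to 4-tuples, fixes which double changes occur. If one does, the inner
  -- one makes the letter of its witness at a fifth position depend only on where that position lies
  -- among the four.
  obtain ⟨M, hM⟩ := ramsey (Fin 5 → Γ) 5 (6 * n₀ + 4)
  obtain ⟨N, hN⟩ := ramsey (Set (Fin 4 → Γ)) 4 (max m M)
  refine ⟨N, fun {Z} W hW => ?_⟩
  obtain ⟨g, hg, K, hK⟩ := hN fun f =>
    {r | r 0 ≠ r 1 ∧ r 2 ≠ r 3 ∧ ∃ z, ∀ t, W (f t) z = r t}
  rcases K.eq_empty_or_nonempty with rfl | ⟨r, hr⟩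
  · have hmono : StrictMono (Fin.castLE (le_max_left m M)) := Fin.strictMono_castLE _
    refine ⟨fun i => g (Fin.castLE (le_max_left m M) i), hg.comp hmono, fun z => ?_⟩
    refine exists_exceptional_position hm _ fun f hf h01 => ?_
    by_contra h23
    have hmem := hK _ (hmono.comp hf)
    rw [Set.eq_empty_iff_forall_notMem] at hmem
    exact hmem (fun t => W (g (Fin.castLE (le_max_left m M) (f t))) z)
      ⟨h01, h23, z, fun t => rfl⟩
  · exfalso
    have hwit : ∀ f : Fin 4 → Fin (max m M), StrictMono f →
        r 0 ≠ r 1 ∧ r 2 ≠ r 3 ∧ ∃ z, ∀ t, W (g (f t)) z = r t := fun f hf => by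
      have := hK f hf
      rw [← this] at hr
      exact hr
    have h4 : 4 ≤ 6 * n₀ + 4 := by omega
    set ιM : Fin M → Fin (max m M) := Fin.castLE (le_max_right m M)
    have hιM : StrictMono ιM := Fin.strictMono_castLE _
    obtain ⟨z₀⟩ : Nonempty Z := by
      -- The coloring is a dummy: only the embedding into `Fin M` is needed, to supply a 4-tuple.
      obtain ⟨g', hg', -⟩ := hM fun _ _ => r 0
      obtain ⟨-, -, z, -⟩ := hwit _ (hιM.comp (hg'.comp (Fin.strictMono_castLE h4)))
      exact ⟨z⟩
    have hex : ∀ f : Fin 4 → Fin M, ∃ z : Z, StrictMono f → ∀ t, W (g (ιM (f t))) z = r t :=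
      fun f => by
        by_cases hf : StrictMono f
        · obtain ⟨-, -, z, hz⟩ := hwit _ (hιM.comp hf)
          exact ⟨z, fun _ => hz⟩
        · exact ⟨z₀, fun h => absurd h hf⟩
    choose e he using hex
    obtain ⟨g', hg', k, hk⟩ := hM fun f t => W (g (ιM (f t))) (e fun j => f (t.succAbove j))
    obtain ⟨hr01, hr23, -⟩ := hwit _ (hιM.comp (hg'.comp (Fin.strictMono_castLE h4)))
    have hwords := gridCoded_of_words (n := n₀) rfl (fun i z => W (g (ιM (g' i))) z)
      (fun f => e fun j => g' (f j)) (A := k 0) (B := k 1) (C := k 2) (D := k 3) (E := k 4)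
      hr01 hr23 fun i₁ i₂ i₃ i₄ h12 h23 h34 => by
        have hspec := he _ (hg'.comp (strictMono_vec4 h12 h23 h34))
        have hfive : ∀ f : Fin 5 → Fin (6 * n₀ + 4), StrictMono f → ∀ (t : Fin 5) {i}
            {f' : Fin 4 → Fin (6 * n₀ + 4)}, f t = i → (fun j => f (t.succAbove j)) = f' →
            W (g (ιM (g' i))) (e fun j => g' (f' j)) = k t := by
          rintro f hf t _ _ rfl rfl
          exact congrFun (hk f hf) t
        have hv : ∀ {a b c d : Fin (6 * n₀ + 4)} {f : Fin 4 → Fin (6 * n₀ + 4)}, f 0 = a →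
            f 1 = b → f 2 = c → f 3 = d → f = ![a, b, c, d] := by
          rintro _ _ _ _ f rfl rfl rfl rfl
          ext t
          fin_cases t <;> rfl
        exact ⟨fun i h => hfive _ (strictMono_vec5 h h12 h23 h34) 0 rfl (hv rfl rfl rfl rfl),
          hspec 0,
          fun i h h' => hfive _ (strictMono_vec5 h h' h23 h34) 1 rfl (hv rfl rfl rfl rfl),
          hspec 1,
          fun i h h' => hfive _ (strictMono_vec5 h12 h h' h34) 2 rfl (hv rfl rfl rfl rfl),
          hspec 2,
          fun i h h' => hfive _ (strictMono_vec5 h12 h23 h h') 3 rfl (hv rfl rfl rfl rfl),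
          hspec 3,
          fun i h => hfive _ (strictMono_vec5 h12 h23 h34 h) 4 rfl (hv rfl rfl rfl rfl)⟩
    obtain ⟨p, q, x, y, e', he'⟩ := hwords
    refine hW p q (fun i t => g (ιM (g' (x (Fin.castLE (hle p q) i) t))))
      (fun i t => g (ιM (g' (y (Fin.castLE (hle p q) i) t))))
      ⟨fun i j => e' (Fin.castLE (hle p q) i) (Fin.castLE (hle p q) j), fun i j i' j' => ?_⟩
    rw [← (Fin.castLE_injective (hle p q)).eq_iff (a := i'),
      ← (Fin.castLE_injective (hle p q)).eq_iff (a := j')]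
    exact he' _ _ _ _

/-- If the letters of words indexed by a long sequence do not define long half-graphs, then on a
subsequence no word starts with a long constant block and ends with a different one. -/
theorem exists_subsequence_forall_not_two_blocks (Γ : Type*) [Finite Γ] (n : Γ → ℕ) :
    ∃ K, ∀ m, ∃ N, ∀ {Z : Type w} (W : Fin N → Z → Γ),
      (∀ u (x : Fin (n u) → Fin N) (y : Fin (n u) → Z), ¬ ∀ i j, W (x i) (y j) = u ↔ i ≤ j) →
      ∃ g : Fin m → Fin N, StrictMono g ∧ ∀ (f : Fin (2 * K) → Fin m), StrictMono f →
        ∀ z u v, (∀ t : Fin (2 * K), (t : ℕ) < K → W (g (f t)) z = u) →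
          (∀ t : Fin (2 * K), K ≤ (t : ℕ) → W (g (f t)) z = v) → u = v := by
  classical
  have := Fintype.ofFinite Γ
  set K := ∑ u, n u with hK
  have hle : ∀ u, n u ≤ K := fun u =>
    Finset.single_le_sum (f := n) (fun _ _ => Nat.zero_le _) (Finset.mem_univ u)
  refine ⟨K, fun m => ?_⟩
  obtain ⟨N, hN⟩ := ramsey (Set (Γ × Γ)) (2 * K) (max m (3 * K))
  refine ⟨N, fun {Z} W hW => ?_⟩
  obtain ⟨g, hg, c, hc⟩ := hN fun f => {r | r.1 ≠ r.2 ∧ ∃ z,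
    (∀ t : Fin (2 * K), (t : ℕ) < K → W (f t) z = r.1) ∧
    (∀ t : Fin (2 * K), K ≤ (t : ℕ) → W (f t) z = r.2)}
  rcases c.eq_empty_or_nonempty with rfl | ⟨⟨u, v⟩, hr⟩
  · have hmono : StrictMono (Fin.castLE (le_max_left m (3 * K))) := Fin.strictMono_castLE _
    refine ⟨fun i => g (Fin.castLE (le_max_left m (3 * K)) i), hg.comp hmono,
      fun f hf z u v hu hv => ?_⟩
    by_contra huv
    have hmem := hc _ (hmono.comp hf)
    rw [Set.eq_empty_iff_forall_notMem] at hmem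
    exact hmem (u, v) ⟨huv, z, hu, hv⟩
  · exfalso
    have hmono : StrictMono (Fin.castLE (le_max_right m (3 * K))) := Fin.strictMono_castLE _
    have hwit : ∀ f : Fin (2 * K) → Fin (3 * K), StrictMono f → u ≠ v ∧ ∃ z,
        (∀ t : Fin (2 * K), (t : ℕ) < K → W (g (Fin.castLE (le_max_right m (3 * K)) (f t))) z = u) ∧
        (∀ t : Fin (2 * K), K ≤ (t : ℕ) →
          W (g (Fin.castLE (le_max_right m (3 * K)) (f t))) z = v) := fun f hf => by
      have := hc _ (hmono.comp hf)
      rw [← this] at hr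
      exact hr
    -- The window for `z j` starts at `j + 1`, so its change from `u` to `v` lies just after
    -- position `K + j`. Thus position `K + i` carries `u` exactly when `i ≤ j`.
    have hshift : ∀ j : Fin (n u), StrictMono fun t : Fin (2 * K) =>
        (⟨j + 1 + t, by have := hle u; omega⟩ : Fin (3 * K)) := fun j a b hab => by
      rw [Fin.lt_def] at hab ⊢
      exact Nat.add_lt_add_left hab _
    choose huv z hz hz' using fun j => hwit _ (hshift j)
    refine hW u (fun i => g (Fin.castLE (le_max_right m (3 * K))
      ⟨K + i, by have := hle u; omega⟩)) z fun i j => ?_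
    have hi := i.2.trans_le (hle u)
    have hj := j.2.trans_le (hle u)
    constructor
    · intro h
      by_contra hij
      rw [Fin.le_def] at hij
      have h2 := hz' j ⟨K + i - (j + 1), by omega⟩ (by simp; omega)
      refine huv j ?_
      rw [← h, ← h2]
      congr! 4
      simp
      omega
    · intro hij
      rw [Fin.le_def] at hij
      refine Eq.trans ?_ (hz j ⟨K + i - (j + 1), by omega⟩ (by simp; omega))
      congr! 4
      simp
      omega

/-! ### Distinct traces on disjoint sets -/

theorem strictMono_vec3 {m : ℕ} {a b c : Fin m} (h₁ : a < b) (h₂ : b < c) :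
    StrictMono ![a, b, c] := by
  rw [Fin.strictMono_iff_lt_succ]
  intro t
  fin_cases t
  exacts [h₁, h₂]

/-- If `φ` does not code grids relative to disjoint sets, then there are no long sequences whose
members have pairwise distinct `φ`-traces on each of many disjoint sets. -/
theorem exists_bound_pairwise_distinct_traces (n : (Fin 3 → Prop) → ℕ) :
    ∃ K M, ∀ {Y Z : Type w} (φ : Y → Z → Prop) (B : Fin M → Set Z),
      (∀ i j, i ≠ j → B i ∩ B j = ∅) →
      (∀ p (x : Fin (n p) → Fin M) (y : Fin (n p) → Fin 3 → Y),
        ¬ GridCoded (fun k z => z ∈ B (x k)) (fun l z => ∀ t, φ (y l t) z = p t)) →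
      ∀ a : Fin K → Y, ¬ ∀ i s t, s < t → ∃ b ∈ B i, ¬ (φ (a s) b ↔ φ (a t) b) := by
  classical
  set n₀ := ∑ p, n p with hn₀
  have hle : ∀ p, n p ≤ n₀ := fun p =>
    Finset.single_le_sum (f := n) (fun _ _ => Nat.zero_le _) (Finset.mem_univ p)
  obtain ⟨M, hM⟩ := ramsey (Fin 5 → Prop) 1 n₀
  obtain ⟨K, hK⟩ := ramsey (Fin M → Fin 5 → Prop) 3 (3 * n₀ + 3)
  refine ⟨K, M, fun {Y Z} φ B hB hno a ha => ?_⟩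
  -- `Option` supplies a default for pairs with `s ≥ t`, since `Z` may be empty.
  have hex : ∀ (i : Fin M) (s t : Fin K), ∃ b : Option Z, s < t →
      ∃ b' ∈ B i, b = some b' ∧ ¬ (φ (a s) b' ↔ φ (a t) b') := fun i s t => by
    by_cases hst : s < t
    · obtain ⟨b, hb, hb'⟩ := ha i s t hst
      exact ⟨some b, fun _ => ⟨b, hb, rfl, hb'⟩⟩
    · exact ⟨none, fun h => absurd h hst⟩
  choose b hb using hex
  set T : Fin M → Fin K → Fin K → Fin K → Prop := fun i r s t => ∃ z, b i s t = some z ∧ φ (a r) z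
    with hT
  -- The five entries are the positions of `r` relative to `s < t`: before, between, after, equal to
  -- `s`, equal to `t`. As `r` varies, the word of `b i s t` is `0…0 3 1…1 4 2…2`, and `3 ≠ 4` by
  -- the choice of `b`. The colors range over all `i < M` at once, so `M` is fixed before `K`.
  obtain ⟨g, hg, c, hc⟩ := hK fun f i => ![T i (f 0) (f 1) (f 2), T i (f 1) (f 0) (f 2),
    T i (f 2) (f 0) (f 1), T i (f 0) (f 0) (f 1), T i (f 1) (f 0) (f 1)]
  obtain ⟨h, hh, c', hc'⟩ := hM fun i => c (i 0)
  have hcol : ∀ (i : Fin n₀) {r s t : Fin (3 * n₀ + 3)}, r < s → s < t →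
      T (h i) (g r) (g s) (g t) = c' 0 ∧ T (h i) (g s) (g r) (g t) = c' 1 ∧
      T (h i) (g t) (g r) (g s) = c' 2 ∧ T (h i) (g r) (g r) (g s) = c' 3 ∧
      T (h i) (g s) (g r) (g s) = c' 4 := fun i r s t hrs hst => by
    have h1 := hc' ![i] (fun x y hxy => absurd hxy (by simp [Subsingleton.elim x y]))
    have h2 := fun x => congrFun (congrFun (hc _ (strictMono_vec3 hrs hst)) (h i)) x
    simp only [Matrix.cons_val_zero] at h1
    rw [h1] at h2
    exact ⟨h2 0, h2 1, h2 2, h2 3, h2 4⟩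
  -- Positions `0` and `3 n₀ + 1` park the fixed end of the pair; `3 n₀ + 2` only completes pairs to
  -- increasing triples for `hcol`.
  have hlen : 1 + 3 * n₀ ≤ 3 * n₀ + 3 := by omega
  set pos := fun (k : Fin n₀) (t : Fin 3) => triplePos 1 n₀ hlen k k.2 t with hpos
  -- It is enough to vary one end of the pair `(s, t)`.
  have finish : ∀ (p : Fin 3 → Prop) (s t : Fin n₀ → Fin (3 * n₀ + 3)), (∀ l, s l < t l) →
      (∀ i l l', (∀ r, T (h i) (g (pos l' r)) (g (s l)) (g (t l)) = p r) ↔ l' = l) → False := by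
    intro p s t hst hp
    choose e heB he _ using fun (i : Fin n₀) (l : Fin n₀) => hb (h i) _ _ (hg (hst l))
    have hφ : ∀ i l r, T (h i) r (g (s l)) (g (t l)) = φ (a r) (e i l) := fun i l r => by
      simp [hT, he]
    refine hno p (fun k => h (Fin.castLE (hle p) k)) (fun l r => a (g (pos (Fin.castLE (hle p) l) r)))
      ⟨fun k l => e (Fin.castLE (hle p) k) (Fin.castLE (hle p) l), fun k l k' l' => ?_⟩
    rw [← (Fin.castLE_injective (hle p)).eq_iff (a := l'), ← hp (Fin.castLE (hle p) k)]
    simp only [hφ]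
    -- Disjointness of the sets `B` recovers the row of a grid point.
    refine and_congr ⟨fun hk => ?_, ?_⟩ Iff.rfl
    · by_contra hkk
      have : h (Fin.castLE (hle p) k') ≠ h (Fin.castLE (hle p) k) := fun heq =>
        hkk (Fin.castLE_injective _ (hh.injective heq))
      exact Set.eq_empty_iff_forall_notMem.1 (hB _ _ this) _ ⟨hk, heB _ _⟩
    · rintro rfl
      exact heB _ _
  rcases Nat.eq_zero_or_pos n₀ with h0 | h0
  · exact finish (fun _ => True) (fun l => 0) (fun l => 1) (fun l => absurd l.2 (by omega))
      (fun i => absurd i.2 (by omega))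
  by_cases hev : c' 0 = c' 3 ∧ c' 3 = c' 1
  · refine finish ![c' 1, c' 4, c' 2] (fun l => ⟨0, by omega⟩) (fun l => pos l 1)
      (fun l => by simp [Fin.lt_def, hpos, triplePos]) fun i l l' => ?_
    rw [Fin.ext_iff]
    refine triple_eq_iff (fun r => T (h i) (g r) (g ⟨0, by omega⟩) (g (pos l 1))) hlen l.2 l'.2
      ?_ ?_ ?_ ?_
    · rintro ⟨h1, -⟩
      have hlt : g ⟨0, by omega⟩ < g (pos l 1) := hg (by simp [Fin.lt_def, hpos, triplePos])
      obtain ⟨z, -, hz, hne⟩ := hb (h i) _ _ hlt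
      have h2 := hcol i (r := ⟨0, by omega⟩) (s := pos l 1) (t := ⟨3 * n₀ + 2, by omega⟩)
        (by simp [Fin.lt_def, hpos, triplePos]) (by simp [Fin.lt_def, hpos, triplePos]; omega)
      apply hne
      have h3 : T (h i) (g ⟨0, by omega⟩) (g ⟨0, by omega⟩) (g (pos l 1)) =
          T (h i) (g (pos l 1)) (g ⟨0, by omega⟩) (g (pos l 1)) := by
        rw [h2.2.2.2.1, h2.2.2.2.2, hev.2, h1]
      simp only [hT, hz, Option.some.injEq, exists_eq_left', eq_iff_iff] at h3
      exact h3
    · intro r hr hr'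
      exact (hcol i (r := ⟨0, by omega⟩) (s := r) (t := pos l 1)
        (by rw [Fin.lt_def]; exact hr) (by rw [Fin.lt_def]; exact hr')).2.1
    · exact (hcol i (r := ⟨0, by omega⟩) (s := pos l 1) (t := ⟨3 * n₀ + 2, by omega⟩)
        (by simp [Fin.lt_def, hpos, triplePos])
        (by simp [Fin.lt_def, hpos, triplePos]; omega)).2.2.2.2
    · intro r hr hr'
      exact (hcol i (r := ⟨0, by omega⟩) (s := pos l 1) (t := r)
        (by simp [Fin.lt_def, hpos, triplePos]) (by rw [Fin.lt_def]; exact hr)).2.2.1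
  · refine finish ![c' 0, c' 3, c' 1] (fun l => pos l 1) (fun l => ⟨3 * n₀ + 1, by omega⟩)
      (fun l => by simp [Fin.lt_def, hpos, triplePos]; omega) fun i l l' => ?_
    rw [Fin.ext_iff]
    refine triple_eq_iff (fun r => T (h i) (g r) (g (pos l 1)) (g ⟨3 * n₀ + 1, by omega⟩)) hlen
      l.2 l'.2 hev ?_ ?_ ?_
    · intro r hr hr'
      exact (hcol i (r := r) (s := pos l 1) (t := ⟨3 * n₀ + 1, by omega⟩)
        (by rw [Fin.lt_def]; exact hr')
        (by simp [Fin.lt_def, hpos, triplePos]; omega)).1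
    · exact (hcol i (r := pos l 1) (s := ⟨3 * n₀ + 1, by omega⟩) (t := ⟨3 * n₀ + 2, by omega⟩)
        (by simp [Fin.lt_def, hpos, triplePos]; omega)
        (by simp [Fin.lt_def])).2.2.2.1
    · intro r hr hr'
      exact (hcol i (r := pos l 1) (s := r) (t := ⟨3 * n₀ + 1, by omega⟩)
        (by rw [Fin.lt_def]; exact hr) (by rw [Fin.lt_def]; simp; omega)).2.1

/-! ### Uniform definability and coding in classes of structures -/

namespace MonadicNIP

variable {L : FirstOrder.Language.{u, v}} {X Y : Type}

/-- A relation on all `L`-structures that is defined by one formula. -/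
def UniformlyDefinable (R : ∀ A : Bundled.{w} L.Structure, (X → A) → Prop) : Prop :=
  ∃ φ : L.Formula X, ∀ (A : Bundled.{w} L.Structure) (v : X → A), φ.Realize v ↔ R A v

namespace UniformlyDefinable

variable {R S : ∀ A : Bundled.{w} L.Structure, (X → A) → Prop}

theorem of_formula (φ : L.Formula X) :
    UniformlyDefinable fun (A : Bundled.{w} L.Structure) (v : X → A) => φ.Realize v :=
  ⟨φ, fun _ _ => Iff.rfl⟩

theorem comp (hR : UniformlyDefinable R) (f : X → Y) :
    UniformlyDefinable fun (A : Bundled.{w} L.Structure) (v : Y → A) => R A (v ∘ f) := by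
  obtain ⟨φ, hφ⟩ := hR
  exact ⟨φ.relabel f, fun A v => by rw [Language.Formula.realize_relabel, hφ]⟩

theorem not (hR : UniformlyDefinable R) : UniformlyDefinable fun A v => ¬ R A v := by
  obtain ⟨φ, hφ⟩ := hR
  exact ⟨φ.not, fun A v => by rw [Language.Formula.realize_not, hφ]⟩

theorem imp (hR : UniformlyDefinable R) (hS : UniformlyDefinable S) :
    UniformlyDefinable fun A v => R A v → S A v := by
  obtain ⟨φ, hφ⟩ := hR
  obtain ⟨ψ, hψ⟩ := hS
  exact ⟨φ.imp ψ, fun A v => by rw [Language.Formula.realize_imp, hφ, hψ]⟩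

theorem iff (hR : UniformlyDefinable R) (hS : UniformlyDefinable S) :
    UniformlyDefinable fun A v => R A v ↔ S A v := by
  obtain ⟨φ, hφ⟩ := hR
  obtain ⟨ψ, hψ⟩ := hS
  exact ⟨φ.iff ψ, fun A v => by rw [Language.Formula.realize_iff, hφ, hψ]⟩

theorem forall_fin {ι : Type} [Finite ι] {R : ι → ∀ A : Bundled.{w} L.Structure, (X → A) → Prop}
    (hR : ∀ i, UniformlyDefinable (R i)) : UniformlyDefinable fun A v => ∀ i, R i A v := by
  choose φ hφ using hR
  exact ⟨Language.Formula.iInf φ, fun A v => by simp [Language.Formula.realize_iInf, hφ]⟩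

theorem iff_const (hR : UniformlyDefinable R) (p : Prop) :
    UniformlyDefinable fun A v => R A v ↔ p := by
  by_cases hp : p
  · simpa [hp] using hR
  · simpa [hp] using hR.not

theorem forall_elem {R : ∀ A : Bundled.{w} L.Structure, (X ⊕ Unit → A) → Prop}
    (hR : UniformlyDefinable R) :
    UniformlyDefinable fun (A : Bundled.{w} L.Structure) (v : X → A) =>
      ∀ b, R A (Sum.elim v fun _ => b) := by
  obtain ⟨φ, hφ⟩ := hR
  refine ⟨φ.iAlls Unit, fun A v => ?_⟩
  rw [Language.Formula.realize_iAlls]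
  simp only [hφ]
  exact ⟨fun h b => h fun _ => b, fun h i => h (i ())⟩

end UniformlyDefinable

/-- The expansion of a structure by a unary predicate. -/
def expandByPred (A : Bundled.{w} L.Structure) (P : Set A) :
    Bundled.{w} (monadicExt L Unit).Structure :=
  letI : (colorLang Unit).Structure A :=
    { funMap := fun f => nomatch f
      RelMap := fun r v => match r, v with
        | .color _, v => v 0 ∈ P }
  ⟨A, inferInstanceAs ((L.sum (colorLang Unit)).Structure A)⟩

theorem expandByPred_mem {C : Set (Bundled.{w} L.Structure)} {A : Bundled.{w} L.Structure}
    (hA : A ∈ C) (P : Set A) : expandByPred A P ∈ monadicExpansions C Unit :=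
  hA

/-- The formula over the monadic extension that says that a variable has the given color. -/
def predFormula (x : X) : (monadicExt L Unit).Formula X :=
  Language.Relations.formula₁ (L := monadicExt L Unit) (Sum.inr (ColorRel.color ()))
    (Language.Term.var x)

theorem realize_predFormula (A : Bundled.{w} L.Structure) (P : Set A) (x : X) (v : X → A) :
    (predFormula (L := L) x).Realize (M := expandByPred A P) v ↔ v x ∈ P := by
  rw [predFormula]
  erw [Language.Formula.realize_rel₁]
  exact Iff.rfl

theorem realize_sumInl (A : Bundled.{w} L.Structure) (P : Set A) (φ : L.Formula X) (v : X → A) :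
    ((Language.LHom.sumInl : L →ᴸ monadicExt L Unit).onFormula φ).Realize
      (M := expandByPred A P) v ↔ φ.Realize v := by
  let : L.Structure (expandByPred A P) := A.str
  have : (Language.LHom.sumInl : L →ᴸ monadicExt L Unit).IsExpansionOn (expandByPred A P) :=
    ⟨fun _ _ => rfl, fun _ _ => rfl⟩
  exact Language.LHom.realize_onFormula (M := expandByPred A P) _ φ

/-- In a monadically NIP class, no formula codes arbitrarily large grids of elements. -/
theorem IsMonadicallyNIP.exists_not_gridCoded {C : Set (Bundled.{w} L.Structure)}
    (hC : IsMonadicallyNIP C) [Finite X] [Finite Y]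
    {R : ∀ A : Bundled.{w} L.Structure, (X ⊕ Unit → A) → Prop}
    {S : ∀ A : Bundled.{w} L.Structure, (Y ⊕ Unit → A) → Prop}
    (hR : UniformlyDefinable R) (hS : UniformlyDefinable S) :
    ∃ n, ∀ A ∈ C, ∀ (x : Fin n → X → A) (y : Fin n → Y → A),
      ¬ GridCoded (fun k z => R A (Sum.elim (x k) fun _ => z))
        (fun l z => S A (Sum.elim (y l) fun _ => z)) := by
  classical
  by_contra! hcon
  obtain ⟨a, ⟨eX⟩⟩ := Finite.exists_equiv_fin X
  obtain ⟨b, ⟨eY⟩⟩ := Finite.exists_equiv_fin Y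
  obtain ⟨ρ, hρ⟩ := hR
  obtain ⟨σ, hσ⟩ := hS
  let ψ : L.Formula ((Fin a ⊕ Fin b) ⊕ Unit) :=
    (ρ.relabel (Sum.map (Sum.inl ∘ eX) id)) ⊓ (σ.relabel (Sum.map (Sum.inr ∘ eY) id))
  let θ : (monadicExt L Unit).Formula (Fin a ⊕ Fin b) :=
    (predFormula (Sum.inr ()) ⊓ (Language.LHom.sumInl : L →ᴸ monadicExt L Unit).onFormula ψ).iExs
      Unit
  refine hC Unit a b θ fun n => ?_
  let N := Fintype.card (Set (Fin n))
  have hN : n ≤ N := by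
    have : N = 2 ^ n := by simp [N]
    rw [this]
    exact Nat.lt_two_pow_self.le
  obtain ⟨A, hA, x, y, e, he⟩ := hcon N
  let ν : Set (Fin n) ≃ Fin N := Fintype.equivFin _
  let x' : Fin n → Fin a → A := fun k i => x (Fin.castLE hN k) (eX.symm i)
  -- Columns enumerate the subsets of `Fin n`, and the point in row `k` and column `T` is marked
  -- when `k ∈ T`. So `θ` shatters the first `n` rows.
  let P : Set A := {z | ∃ k T, k ∈ T ∧ z = e (Fin.castLE hN k) (ν T)}
  have hθ : ∀ (k : Fin n) (T : Set (Fin n)),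
      θ.Realize (M := expandByPred A P) (Sum.elim (x' k) fun i => y (ν T) (eY.symm i)) ↔ k ∈ T := by
    intro k T
    have hψ : ∀ z, ψ.Realize (Sum.elim (Sum.elim (x' k) fun i => y (ν T) (eY.symm i))
        fun _ : Unit => z) ↔ R A (Sum.elim (x (Fin.castLE hN k)) fun _ => z) ∧
          S A (Sum.elim (y (ν T)) fun _ => z) := by
      intro z
      rw [Language.Formula.realize_inf, Language.Formula.realize_relabel,
        Language.Formula.realize_relabel, hρ, hσ]
      refine and_congr (iff_of_eq ?_) (iff_of_eq ?_) <;> congr 1 <;> ext i <;>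
        rcases i with i | i <;> simp [x']
    have hθ' : θ.Realize (M := expandByPred A P)
        (Sum.elim (x' k) fun i => y (ν T) (eY.symm i)) ↔
        ∃ z : A, z ∈ P ∧ ψ.Realize (Sum.elim (Sum.elim (x' k) fun i => y (ν T) (eY.symm i))
          fun _ : Unit => z) := by
      rw [Language.Formula.realize_iExs]
      constructor
      · rintro ⟨i, hi⟩
        rw [Language.Formula.realize_inf] at hi
        exact ⟨i (), (realize_predFormula A P _ _).1 hi.1, (realize_sumInl A P ψ _).1 hi.2⟩
      · rintro ⟨z, hz, hz'⟩
        refine ⟨fun _ => z, ?_⟩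
        rw [Language.Formula.realize_inf]
        exact ⟨(realize_predFormula A P _ _).2 hz, (realize_sumInl A P ψ _).2 hz'⟩
    rw [hθ']
    simp only [hψ]
    constructor
    · rintro ⟨_, ⟨k', T', hk', rfl⟩, h⟩
      obtain ⟨h1, h2⟩ := (he _ _ _ _).1 h
      rw [Fin.castLE_injective hN h1, ν.injective h2]
      exact hk'
    · exact fun hk => ⟨_, ⟨k, T, hk, rfl⟩, (he _ _ _ _).2 ⟨rfl, rfl⟩⟩
  -- The column of `{k}` separates row `k` from every other row.
  have hinj : Function.Injective x' := by
    intro k k' hkk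
    have := hθ k' {k}
    rw [← hkk, hθ k {k}] at this
    exact (this.1 rfl).symm
  have hcard : (n : ℕ∞) ≤ (Set.range x').encard := by
    rw [← Set.image_univ, hinj.encard_image]
    simp
  refine ⟨expandByPred A P, expandByPred_mem hA P, Set.range x', hcard,
    fun T i => y (ν (x' ⁻¹' T)) (eY.symm i), ?_⟩
  rintro T - _ ⟨k, rfl⟩
  exact hθ k _

/-- In a monadically stable class, no formula defines arbitrarily long half-graphs. -/
theorem IsMonadicallyStable.exists_not_halfGraph {C : Set (Bundled.{w} L.Structure)}
    (hC : IsMonadicallyStable C) [Finite X]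
    {R : ∀ A : Bundled.{w} L.Structure, (X ⊕ Unit → A) → Prop} (hR : UniformlyDefinable R) :
    ∃ n, ∀ A ∈ C, ∀ (x : Fin n → X → A) (y : Fin n → A),
      ¬ ∀ i j, R A (Sum.elim (x i) fun _ => y j) ↔ i ≤ j := by
  by_contra! hcon
  obtain ⟨a, ⟨eX⟩⟩ := Finite.exists_equiv_fin X
  obtain ⟨ρ, hρ⟩ := hR
  refine hC Unit a 1 ((Language.LHom.sumInl : L →ᴸ monadicExt L Unit).onFormula
    (ρ.relabel (Sum.map eX fun _ => 0))) fun k => ?_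
  obtain ⟨A, hA, x, y, hxy⟩ := hcon k
  have key : ∀ i j, (ρ.relabel (Sum.map eX fun _ => 0)).Realize
      (Sum.elim (fun t => x i (eX.symm t)) fun _ : Fin 1 => y j) ↔ i ≤ j := by
    intro i j
    rw [← hxy i j, Language.Formula.realize_relabel, hρ]
    refine iff_of_eq ?_
    congr 1
    ext i
    rcases i with i | i <;> simp
  exact ⟨expandByPred A ∅, expandByPred_mem hA ∅, fun i t => x i (eX.symm t), fun j _ => y j,
    fun i j => (realize_sumInl A ∅ _ _).trans (key i j)⟩

end MonadicNIP

/-! ### Exceptional indices, traces and samples in a monadically NIP class -/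

namespace MonadicNIP

variable {L : FirstOrder.Language.{u, v}} {X : Type}

theorem UniformlyDefinable.setOf_eq {ι : Type} [Finite ι]
    {R : ι → ∀ A : Bundled.{w} L.Structure, (X → A) → Prop} (hR : ∀ r, UniformlyDefinable (R r))
    (u : Set ι) : UniformlyDefinable fun A v => {r | R r A v} = u := by
  simp only [Set.ext_iff]
  exact .forall_fin fun r => (hR r).iff_const _

/-- In a monadically NIP class, every long sequence of tuples has a subsequence on which the types
over any given element, with respect to finitely many formulas, are constant before and after some
exceptional index; in a monadically stable class, the two constants agree. -/
theorem IsMonadicallyNIP.exists_exceptional_subsequence {C : Set (Bundled.{w} L.Structure)}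
    (hC : IsMonadicallyNIP C) [Finite X] {ι : Type} [Finite ι]
    {R : ι → ∀ A : Bundled.{w} L.Structure, (X ⊕ Unit → A) → Prop}
    (hR : ∀ r, UniformlyDefinable (R r)) (m : ℕ) :
    ∃ N, 1 ≤ m → ∀ A ∈ C, ∀ c : Fin N → X → A, ∃ g : Fin m → Fin N, StrictMono g ∧
      ∀ z : A, ∃ (ex : Fin m) (u v : Set ι),
        (∀ i < ex, {r | R r A (Sum.elim (c (g i)) fun _ => z)} = u) ∧
        (∀ i, ex < i → {r | R r A (Sum.elim (c (g i)) fun _ => z)} = v) ∧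
        (IsMonadicallyStable C → u = v) := by
  -- A dummy value at `m = 0` makes the bound a total function of `m`.
  rcases Nat.eq_zero_or_pos m with rfl | hm
  · exact ⟨0, fun h => absurd h (by omega)⟩
  have hdef : ∀ p : Fin 3 → Set ι, UniformlyDefinable (X := (Fin 3 × X) ⊕ Unit)
      fun (A : Bundled.{w} L.Structure) v =>
        ∀ t, {r | R r A (v ∘ Sum.map (Prod.mk t) id)} = p t := fun p =>
    .forall_fin fun t => (UniformlyDefinable.setOf_eq hR (p t)).comp _
  choose n hn using fun p q => hC.exists_not_gridCoded (hdef p) (hdef q)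
  have hno : ∀ {N : ℕ} (A) (_ : A ∈ C) (c : Fin N → X → A) (p q : Fin 3 → Set ι)
      (x y : Fin (n p q) → Fin 3 → Fin N),
      ¬ GridCoded (fun k z => ∀ t, {r | R r A (Sum.elim (c (x k t)) fun _ => z)} = p t)
        (fun l z => ∀ t, {r | R r A (Sum.elim (c (y l t)) fun _ => z)} = q t) := by
    intro N A hA c p q x y h
    have hv : ∀ (d : Fin 3 → X → A) (z : A) (t : Fin 3),
        (Sum.elim (fun i : Fin 3 × X => d i.1 i.2) fun _ : Unit => z) ∘ Sum.map (Prod.mk t) id =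
          Sum.elim (d t) fun _ => z := fun d z t => by
      ext i
      rcases i with i | i <;> rfl
    obtain ⟨e, he⟩ := h
    refine hn p q A hA (fun k i => c (x k i.1) i.2) (fun l i => c (y l i.1) i.2)
      ⟨e, fun k l k' l' => (and_congr ?_ ?_).trans (he k l k' l')⟩
    · exact forall_congr' fun t => by rw [hv fun t => c (x k' t)]
    · exact forall_congr' fun t => by rw [hv fun t => c (y l' t)]
  by_cases hst : IsMonadicallyStable C
  · choose h hh using fun u : Set ι => hst.exists_not_halfGraph (.setOf_eq hR u)
    obtain ⟨K, hK⟩ := exists_subsequence_forall_not_two_blocks.{w} (Set ι) h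
    obtain ⟨T, hT⟩ := _root_.exists_exceptional_subsequence.{w} (Set ι) n (m := m + 2 * K) (by omega)
    obtain ⟨N, hN⟩ := hK T
    refine ⟨N, fun _ A hA c => ?_⟩
    obtain ⟨g₁, hg₁, hblock⟩ := hN (fun i z => {r | R r A (Sum.elim (c i) fun _ => z)})
      fun u x y => hh u A hA (fun i => c (x i)) y
    obtain ⟨g₂, hg₂, hexc⟩ := hT (fun i z => {r | R r A (Sum.elim (c (g₁ i)) fun _ => z)})
      (hno A hA fun i => c (g₁ i))
    have hshift : StrictMono fun i : Fin m => (⟨K + i, by omega⟩ : Fin (m + 2 * K)) :=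
      fun a b hab => by
        rw [Fin.lt_def] at hab ⊢
        exact Nat.add_lt_add_left hab _
    refine ⟨fun i => g₁ (g₂ ⟨K + i, by omega⟩), hg₁.comp (hg₂.comp hshift), fun z => ?_⟩
    obtain ⟨ex, u, v, hu, hv⟩ := hexc z
    -- The kept window has `K` positions of padding on each side. If `ex` falls in the padding, the
    -- window sees a single constant, up to one end index declared exceptional. Otherwise the
    -- paddings are blocks of `u` and of `v`, and `hblock` forces `u = v`.
    rcases lt_or_ge (ex : ℕ) K with hlow | hlow
    · refine ⟨⟨0, hm⟩, v, v, fun i hi => absurd hi (by simp [Fin.lt_def]), fun i _ => hv _ ?_,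
        fun _ => rfl⟩
      rw [Fin.lt_def]
      exact hlow.trans_le (Nat.le_add_right _ _)
    rcases lt_or_ge (ex : ℕ) (K + m) with hup | hup
    · refine ⟨⟨ex - K, by omega⟩, u, v, fun i hi => hu _ ?_, fun i hi => hv _ ?_, fun _ => ?_⟩
      · rw [Fin.lt_def] at hi ⊢
        simp only at hi ⊢
        omega
      · rw [Fin.lt_def] at hi ⊢
        simp only at hi ⊢
        omega
      · refine hblock (fun t => g₂ ⟨if (t : ℕ) < K then t else m + t, by split_ifs <;> omega⟩)
          (hg₂.comp fun a b hab => ?_) z u v (fun t ht => hu _ ?_) fun t ht => hv _ ?_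
        · rw [Fin.lt_def] at hab ⊢
          simp only
          split_ifs <;> omega
        · rw [Fin.lt_def]
          simp only [if_pos ht]
          omega
        · rw [Fin.lt_def]
          simp only [if_neg ht.not_gt]
          omega
    · refine ⟨⟨m - 1, by omega⟩, u, u, fun i _ => hu _ ?_,
        fun i hi => absurd hi (by rw [Fin.lt_def]; simp only; omega), fun _ => rfl⟩
      rw [Fin.lt_def]
      simp only
      omega
  · obtain ⟨N, hN⟩ := _root_.exists_exceptional_subsequence.{w} (Set ι) n hm
    refine ⟨N, fun _ A hA c => ?_⟩
    obtain ⟨g, hg, h⟩ := hN (fun i z => {r | R r A (Sum.elim (c i) fun _ => z)}) (hno A hA c)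
    refine ⟨g, hg, fun z => ?_⟩
    obtain ⟨ex, u, v, hu, hv⟩ := h z
    exact ⟨ex, u, v, hu, hv, fun h => absurd h hst⟩

theorem mem_nbhd {M : Type w} [L.Structure M] {p : ℕ} {φ : L.Formula (Fin p ⊕ Fin 1)}
    {a : Fin p → M} {b : M} : b ∈ nbhd φ a ↔ φ.Realize (Sum.elim a fun _ => b) :=
  Iff.rfl

/-- In a monadically NIP class, elements with pairwise distinct `φ`-traces on each of many disjoint
`α`-neighborhoods are bounded in number. -/
theorem IsMonadicallyNIP.exists_bound_distinct_traces {C : Set (Bundled.{w} L.Structure)}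
    (hC : IsMonadicallyNIP C) {p : ℕ} (φ : L.Formula (Fin 1 ⊕ Fin 1))
    (α : L.Formula (Fin p ⊕ Fin 1)) :
    ∃ K M, ∀ A ∈ C, ∀ c : Fin M → Fin p → A, (∀ i j, i ≠ j → nbhd α (c i) ∩ nbhd α (c j) = ∅) →
      ∀ a : Fin K → A, ¬ ∀ i s t, s < t →
        nbhd α (c i) ∩ nbhd φ (fun _ => a s) ≠ nbhd α (c i) ∩ nbhd φ (fun _ => a t) := by
  have hα : UniformlyDefinable fun (A : Bundled.{w} L.Structure) (v : Fin p ⊕ Unit → A) =>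
      α.Realize (v ∘ Sum.map id fun _ => ()) := (UniformlyDefinable.of_formula α).comp _
  have hφ : ∀ q : Fin 3 → Prop, UniformlyDefinable
      fun (A : Bundled.{w} L.Structure) (v : Fin 3 ⊕ Unit → A) =>
        ∀ t, φ.Realize (v ∘ Sum.map (fun _ => t) fun _ => ()) ↔ q t := fun q =>
    .forall_fin fun t => ((UniformlyDefinable.of_formula φ).comp _).iff_const _
  choose n hn using fun q => hC.exists_not_gridCoded hα (hφ q)
  obtain ⟨K, M, hKM⟩ := exists_bound_pairwise_distinct_traces.{w} n
  refine ⟨K, M, fun A hA c hc a ha => ?_⟩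
  refine hKM (fun a b => b ∈ nbhd φ fun _ => a) (fun i => nbhd α (c i)) hc
    (fun q x y h => hn q A hA (fun k => c (x k)) (fun l t => y l t) ?_) a fun i s t hst => ?_
  · convert h using 5 with k z k z t
    · rw [mem_nbhd]
      refine iff_of_eq (congrArg _ ?_)
      ext i
      rcases i with i | i <;> rfl
    · rw [eq_iff_iff, mem_nbhd]
      refine iff_of_eq (congrArg₂ _ (congrArg _ ?_) rfl)
      ext i
      rcases i with i | i <;> rfl
  · by_contra! hcon
    refine ha i s t hst (Set.ext fun b => and_congr_right fun hb => hcon b hb)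

/-- A maximal family of elements that are pairwise separated along many indices. -/
theorem exists_maximal_separated {A : Type w} {N K : ℕ} (D : Fin N → A → A → Prop) (f : ℕ → ℕ)
    (h₀ : f 0 = N)
    (hK : ¬ ∃ (s : Fin K → A) (g : Fin (f K) → Fin N), StrictMono g ∧
      ∀ i a b, a < b → D (g i) (s a) (s b)) :
    ∃ j < K, ∃ (s : Fin j → A) (g : Fin (f j) → Fin N), StrictMono g ∧
      ∀ (a : A) (T : Finset (Fin (f j))), (∀ i ∈ T, ∀ t, D (g i) (s t) a) → T.card < f (j + 1) := by
  by_contra! hcon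
  -- Greedy construction: an element separated from all samples along `f (j + 1)` indices is
  -- appended, and the sequence is restricted to these indices.
  have key : ∀ j ≤ K, ∃ (s : Fin j → A) (g : Fin (f j) → Fin N), StrictMono g ∧
      ∀ i a b, a < b → D (g i) (s a) (s b) := by
    intro j
    induction j with
    | zero => exact fun _ => ⟨Fin.elim0, Fin.cast h₀, fun _ _ h => h, fun _ a => a.elim0⟩
    | succ j ih =>
      intro hj
      obtain ⟨s, g, hg, hs⟩ := ih (by omega)
      obtain ⟨a, T, hT, hcard⟩ := hcon j hj s g hg
      refine ⟨Fin.snoc (α := fun _ => A) s a, fun i => g (T.orderEmbOfCardLe hcard i),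
        hg.comp (T.orderEmbOfCardLe hcard).strictMono, fun i x y hxy => ?_⟩
      have hmem := T.orderEmbOfCardLe_mem hcard i
      induction y using Fin.lastCases with
      | last =>
        induction x using Fin.lastCases with
        | last => exact absurd hxy (lt_irrefl _)
        | cast x => simpa using hT _ hmem x
      | cast y =>
        induction x using Fin.lastCases with
        | last => exact absurd hxy (Fin.castSucc_lt_last y).not_gt
        | cast x => simpa using hs _ x y (by simpa using hxy)
  exact hK (key K le_rfl)

end MonadicNIP

/-! ### Types over samples, and the main theorem -/

namespace MonadicNIP

variable {L : FirstOrder.Language.{u, v}}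

/-- The formulas in `(x̄, s̄, z)` which describe `z` relative to `x̄` and the samples `s̄`: `none` says
that `z` lies in the `α`-neighborhood of `x̄`, and `some t` that `z` and `s t` have the same
`φ`-trace on it. -/
def traceRel {p j : ℕ} (φ : L.Formula (Fin 1 ⊕ Fin 1)) (α : L.Formula (Fin p ⊕ Fin 1)) :
    Option (Fin j) → ∀ A : Bundled.{w} L.Structure, ((Fin p ⊕ Fin j) ⊕ Unit → A) → Prop
  | none, _, v => v (Sum.inr ()) ∈ nbhd α fun i => v (Sum.inl (Sum.inl i))
  | some t, A, v => ∀ b : A, b ∈ nbhd α (fun i => v (Sum.inl (Sum.inl i))) →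
      (b ∈ nbhd φ (fun _ => v (Sum.inr ())) ↔ b ∈ nbhd φ fun _ => v (Sum.inl (Sum.inr t)))

theorem uniformlyDefinable_mem_nbhd {X : Type} {p : ℕ} (α : L.Formula (Fin p ⊕ Fin 1))
    (f : Fin p → X) (x : X) :
    UniformlyDefinable fun (A : Bundled.{w} L.Structure) (v : X → A) =>
      v x ∈ nbhd α fun i => v (f i) := by
  obtain ⟨ψ, hψ⟩ := (UniformlyDefinable.of_formula α).comp (Sum.elim f fun _ => x)
  refine ⟨ψ, fun A v => (hψ A v).trans (iff_of_eq (congrArg _ ?_))⟩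
  ext i
  rcases i with i | i <;> rfl

theorem uniformlyDefinable_traceRel {p j : ℕ} (φ : L.Formula (Fin 1 ⊕ Fin 1))
    (α : L.Formula (Fin p ⊕ Fin 1)) (r : Option (Fin j)) :
    UniformlyDefinable.{u, v, w} (traceRel φ α r) := by
  rcases r with _ | t
  · exact uniformlyDefinable_mem_nbhd α _ _
  · exact UniformlyDefinable.forall_elem (R := fun A v =>
      v (Sum.inr ()) ∈ nbhd α (fun i => v (Sum.inl (Sum.inl (Sum.inl i)))) →
        (v (Sum.inr ()) ∈ nbhd φ (fun _ => v (Sum.inl (Sum.inr ()))) ↔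
          v (Sum.inr ()) ∈ nbhd φ fun _ => v (Sum.inl (Sum.inl (Sum.inr t)))))
      ((uniformlyDefinable_mem_nbhd α _ _).imp
        ((uniformlyDefinable_mem_nbhd φ _ _).iff (uniformlyDefinable_mem_nbhd φ _ _)))

theorem traceRel_some {p j : ℕ} {φ : L.Formula (Fin 1 ⊕ Fin 1)} {α : L.Formula (Fin p ⊕ Fin 1)}
    {A : Bundled.{w} L.Structure} {c : Fin p → A} {s : Fin j → A} {z : A} {t : Fin j} :
    traceRel φ α (some t) A (Sum.elim (Sum.elim c s) fun _ => z) ↔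
      nbhd α c ∩ nbhd φ (fun _ => z) = nbhd α c ∩ nbhd φ (fun _ => s t) := by
  constructor
  · exact fun h => Set.ext fun b => and_congr_right fun hb => h b hb
  · exact fun h b hb => (and_congr_right_iff (a := b ∈ nbhd α c)).1 (Set.ext_iff.1 h b) hb

end MonadicNIP

theorem mainTheorem5 {L : FirstOrder.Language.{u, v}} [L.IsRelational]
    (C : Set (Bundled.{w} L.Structure)) (hne : ∀ A ∈ C, Nonempty A)
    (hC : MonadicNIP.IsMonadicallyNIP C)
    (p : ℕ) (φ : L.Formula (Fin 1 ⊕ Fin 1)) (α : L.Formula (Fin p ⊕ Fin 1)) :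
    ∃ (N : ℕ → ℕ) (k : ℕ), ∀ m : ℕ, 1 ≤ m → ∀ A ∈ C, ∀ J : Fin (N m) → (Fin p → A),
      (∀ i j, i ≠ j → MonadicNIP.nbhd α (J i) ∩ MonadicNIP.nbhd α (J j) = ∅) →
      ∃ (ι : Fin m → Fin (N m)) (S : Finset A), StrictMono ι ∧ S.card ≤ k ∧
        ∃ (ex : A → Fin m) (sLT sGT : A → A), ∀ a : A, sLT a ∈ S ∧ sGT a ∈ S ∧
          (∀ i, i < ex a →
            MonadicNIP.nbhd α (J (ι i)) ∩ MonadicNIP.nbhd φ (fun _ => a) =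
              MonadicNIP.nbhd α (J (ι i)) ∩ MonadicNIP.nbhd φ (fun _ => sLT a)) ∧
          (∀ i, ex a < i →
            MonadicNIP.nbhd α (J (ι i)) ∩ MonadicNIP.nbhd φ (fun _ => a) =
              MonadicNIP.nbhd α (J (ι i)) ∩ MonadicNIP.nbhd φ (fun _ => sGT a)) ∧
          (∀ i, a ∈ MonadicNIP.nbhd α (J (ι i)) → i = ex a) ∧
          (MonadicNIP.IsMonadicallyStable C → sLT a = sGT a) := by
  classical
  obtain ⟨K, M, hKM⟩ := hC.exists_bound_distinct_traces φ α
  choose E hE using fun j : ℕ => hC.exists_exceptional_subsequence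
    (MonadicNIP.uniformlyDefinable_traceRel (j := j) φ α)
  -- `F m d` is the number of indices to keep while `d` more samples may be added. It suffices to
  -- extract a sequence of length `m` padded on both sides by one more than the next value `F m (d -
  -- 1)`; at `d = 0` it is the bound `M` on separated families.
  obtain ⟨F, hF₀, hF₁⟩ : ∃ F : ℕ → ℕ → ℕ, (∀ m, F m 0 = M) ∧
      ∀ m d, F m (d + 1) = E (K - (d + 1)) (m + 2 * (F m d + 1)) :=
    ⟨fun m d => Nat.rec M (fun d Fd => E (K - (d + 1)) (m + 2 * (Fd + 1))) d,
      fun _ => rfl, fun _ _ => rfl⟩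
  refine ⟨fun m => F m K, K, fun m hm A hA J hJ => ?_⟩
  have hKK : F m (K - K) = M := by rw [Nat.sub_self, hF₀]
  obtain ⟨j, hjK, hsep⟩ := MonadicNIP.exists_maximal_separated (K := K)
    (fun i a b => MonadicNIP.nbhd α (J i) ∩ MonadicNIP.nbhd φ (fun _ => a) ≠
      MonadicNIP.nbhd α (J i) ∩ MonadicNIP.nbhd φ (fun _ => b)) (fun j => F m (K - j)) rfl (by
      rintro ⟨s, g, hg, hs⟩
      refine hKM A hA (fun i => J (g (Fin.cast hKK.symm i))) (fun x y hxy => hJ _ _ fun h => hxy ?_)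
        s fun i x y hxy => hs _ x y hxy
      exact Fin.cast_injective _ (hg.injective h))
  beta_reduce at hsep
  obtain ⟨G, hG⟩ : ∃ G, G = F m (K - (j + 1)) := ⟨_, rfl⟩
  have hf : F m (K - j) = E j (m + 2 * (G + 1)) := by
    have h1 : K - j = K - (j + 1) + 1 := by omega
    have h2 : K - (K - (j + 1) + 1) = j := by omega
    rw [h1, hF₁, h2, hG]
  rw [hf, ← hG] at hsep
  obtain ⟨s, g, hg, hmax⟩ := hsep
  obtain ⟨h, hh, hexc⟩ := hE j (m + 2 * (G + 1)) (by omega) A hA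
    fun i => Sum.elim (J (g i)) s
  have hgh : StrictMono fun i => g (h i) := hg.comp hh
  -- A set of letters that occurs at more than `G` positions contains some sample.
  have hsample : ∀ (a : A) (u : Set (Option (Fin j))) (T : Finset (Fin (m + 2 * (G + 1)))),
      G < T.card → (∀ i ∈ T, {r | MonadicNIP.traceRel φ α r A
        (Sum.elim (Sum.elim (J (g (h i))) s) fun _ => a)} = u) → ∃ t, some t ∈ u := by
    intro a u T hT hu
    by_contra! hcon
    have := hmax a (T.image h) fun i hi t heq => by
      obtain ⟨i', hi', rfl⟩ := Finset.mem_image.1 hi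
      refine hcon t ?_
      rw [← hu i' hi']
      exact MonadicNIP.traceRel_some.2 heq.symm
    rw [Finset.card_image_of_injective _ hh.injective] at this
    omega
  -- A letter that occurs twice does not say that `a` belongs to the `α`-neighborhood.
  have hnone : ∀ (a : A) (u : Set (Option (Fin j))) (i i' : Fin (m + 2 * (G + 1))), i ≠ i' →
      {r | MonadicNIP.traceRel φ α r A
        (Sum.elim (Sum.elim (J (g (h i))) s) fun _ => a)} = u →
      {r | MonadicNIP.traceRel φ α r A
        (Sum.elim (Sum.elim (J (g (h i'))) s) fun _ => a)} = u →
      a ∉ MonadicNIP.nbhd α (J (g (h i))) := by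
    intro a u i i' hii hi hi' ha
    have h1 : none ∈ u := by rw [← hi]; exact ha
    rw [← hi'] at h1
    exact Set.eq_empty_iff_forall_notMem.1 (hJ _ _ (hgh.injective.ne hii)) a ⟨ha, h1⟩
  choose ex u v hu hv huv using hexc
  -- Without samples separation is vacuous, so maximality would bound the number of all indices by
  -- `G`. Nonemptiness of `A` enters here.
  have hj : Nonempty (Fin j) := by
    by_contra hcon
    obtain ⟨a⟩ := hne A hA
    have := hmax a Finset.univ fun i _ t => (hcon ⟨t⟩).elim
    have h3 := Fintype.card_le_of_injective h hh.injective
    simp only [Finset.card_univ, Fintype.card_fin] at this h3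
    omega
  have hpick : ∀ u : Set (Option (Fin j)), ∃ t, (∃ t, some t ∈ u) → some t ∈ u := fun u => by
    by_cases hu : ∃ t, some t ∈ u
    · exact hu.imp fun t ht _ => ht
    · exact ⟨hj.some, fun h => absurd h hu⟩
  choose pick hpick using hpick
  let mid : Fin m → Fin (m + 2 * (G + 1)) := fun i => ⟨G + 1 + i, by omega⟩
  have hmid : StrictMono mid := fun a b hab => by
    rw [Fin.lt_def] at hab ⊢
    exact Nat.add_lt_add_left hab _
  -- The exceptional index is clamped to the window, so a position in the padding goes to the nearer
  -- end.
  let ex' : A → Fin m := fun a => ⟨min (ex a - (G + 1)) (m - 1), by omega⟩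
  have hlt : ∀ (a : A) (i : Fin m), i < ex' a → mid i < ex a := fun a i hi => by
    simp only [Fin.lt_def, ex', mid] at hi ⊢
    omega
  have hgt : ∀ (a : A) (i : Fin m), ex' a < i → ex a < mid i := fun a i hi => by
    simp only [Fin.lt_def, ex', mid] at hi ⊢
    omega
  refine ⟨fun i => g (h (mid i)), Finset.univ.image s, hgh.comp hmid,
    Finset.card_image_le.trans (by simpa using hjK.le), ex', fun a => s (pick (u a)),
    fun a => s (pick (v a)), fun a => ⟨Finset.mem_image_of_mem _ (Finset.mem_univ _),
      Finset.mem_image_of_mem _ (Finset.mem_univ _), fun i hi => ?_, fun i hi => ?_,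
      fun i hi => ?_, fun hst => congrArg (fun u => s (pick u)) (huv a hst)⟩⟩
  · have hlti := hlt a i hi
    -- The left padding alone gives `G + 1` positions with letter `u a`, so this letter names a
    -- sample.
    have hmem := hpick (u a) (hsample a (u a) (Finset.Iio (mid i)) (by simp [mid]; omega)
      fun i' hi' => hu a i' ((Finset.mem_Iio.1 hi').trans hlti))
    exact MonadicNIP.traceRel_some.1 ((Set.ext_iff.1 (hu a _ hlti) _).2 hmem)
  · have hgti := hgt a i hi
    have hmem := hpick (v a) (hsample a (v a) (Finset.Ioi (mid i)) (by simp [mid]; omega)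
      fun i' hi' => hv a i' (hgti.trans (Finset.mem_Ioi.1 hi')))
    exact MonadicNIP.traceRel_some.1 ((Set.ext_iff.1 (hv a _ hgti) _).2 hmem)
  · by_contra hne'
    -- An outermost padding position repeats the letter at `mid i`, which excludes membership.
    rcases lt_or_gt_of_ne hne' with hlt' | hgt'
    · have h1 := hlt a i hlt'
      have h0 : (⟨0, by omega⟩ : Fin (m + 2 * (G + 1))) < mid i := by
        simp [Fin.lt_def, mid]
      exact hnone a (u a) _ _ h0.ne' (hu a _ h1) (hu a _ (h0.trans h1)) hi
    · have h1 := hgt a i hgt'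
      have h0 : mid i < (⟨m + 2 * (G + 1) - 1, by omega⟩ : Fin (m + 2 * (G + 1))) := by
        simp only [Fin.lt_def, mid]; omega
      exact hnone a (v a) _ _ h0.ne (hv a _ h1) (hv a _ (h1.trans h0)) hi
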